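/- A generalized Haar system is defined as follows. Let $\mathcal A_1,\mathcal A_2,\dots$ be partitions of $[0,1)$ into intervals $[\alpha,\beta)$, $\alpha<\beta$, such that $\mathcal A_1=\{[0,1)\}$; for every $n\ge 1$, $\mathcal A_{n+1}$ is obtained from $\mathcal A_n$ by splitting one of its intervals into two (not necessarily equal) intervals and keeping all the others; and $\max_{A\in\mathcal A_n}|A|\to 0$ as $n\to\infty$. A sequence of real functions $f_n$, $n=1,2,\dots$, in $L^1(0,1)$ is a generalized Haar system if, for some such sequence of partitions, every $f_n$ is constant on each $A\in\mathcal A_n$, $\int_A f_n=0$ for every $A\in\mathcal A_{n-1}$, $n\ge 2$, and $\|f_n\|_{L^2(0,1)}=1$ for all $n\geq 1$. Let $\{f_n\}_{n\ge1}$ be a generalized Haar system and let $\sigma$ be a permutation of $\{1,2,\dots\}$. Then $\{f_{\sigma(n)}\}_{n\ge1}$ is an orthonormal system in $L^2(0,1)$, and the sequence $\log_2 n$ (which is nonnegative and increases to infinity) is an a.e. convergence Weyl multiplier for it: for all real numbers $a_1,a_2,\dots$ with $\sum_{n=1}^\infty a_n^2\log_2 n<\infty$, the series $$\sum_{n=1}^\infty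 a_n f_{\sigma(n)}(x)$$ converges for almost every $x\in[0,1)$. -/

import Mathlib

open Filter Topology MeasureTheory

namespace GenHaar

/-- Lebesgue measure on `[0,1)`. -/
noncomputable def unitMeasure : Measure ℝ := volume.restrict (Set.Ico 0 1)

/-- A (countable, measurable) partition of `[0,1)` into pairwise disjoint nonempty sets. -/
structure IsPartition (P : Set (Set ℝ)) : Prop where
  countable : P.Countable
  measurableSet : ∀ A ∈ P, MeasurableSet A
  nonempty : ∀ A ∈ P, A.Nonempty
  pairwiseDisjoint : P.PairwiseDisjoint id
  sUnion_eq : ⋃₀ P = Set.Ico 0 1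

/-- A filtration: a sequence of partitions of `[0,1)` such that every element of a partition is a
union of elements of the next one. (Sequences are indexed by `ℕ`, starting at `0`.) -/
structure IsFiltration (𝒜 : ℕ → Set (Set ℝ)) : Prop where
  isPartition : ∀ n, IsPartition (𝒜 n)
  union_of_next : ∀ n, ∀ A ∈ 𝒜 n, ∃ S ⊆ 𝒜 (n + 1), A = ⋃₀ S

/-- The children, in `𝒜 (n + 1)`, of an element `A` of `𝒜 n`. -/
def children (𝒜 : ℕ → Set (Set ℝ)) (n : ℕ) (A : Set ℝ) : Set (Set ℝ) :=
  {B | B ∈ 𝒜 (n + 1) ∧ B ⊆ A}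

/-- `f` is a martingale difference based on the filtration `𝒜`: each `f n` is integrable on `[0,1)`
and constant on every element of `𝒜 n`, and `f (n + 1)` has integral zero over every element
of `𝒜 n`. -/
structure IsMartingaleDifference (𝒜 : ℕ → Set (Set ℝ)) (f : ℕ → ℝ → ℝ) : Prop where
  isFiltration : IsFiltration 𝒜
  integrable : ∀ n, Integrable (f n) unitMeasure
  const_on : ∀ n, ∀ A ∈ 𝒜 n, ∀ x ∈ A, ∀ y ∈ A, f n x = f n y
  integral_eq_zero : ∀ n, ∀ A ∈ 𝒜 n, ∫ x in A, f (n + 1) x = 0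

/-- The filtrations underlying generalized Haar systems: start from the single interval `[0,1)`;
at each step one interval of the current partition is replaced by two children intervals (not
necessarily of equal length), all other intervals being kept; the maximal length of the intervals
tends to zero (so that every interval is split sooner or later). -/
structure IsHaarFiltration (𝒜 : ℕ → Set (Set ℝ)) : Prop where
  isFiltration : IsFiltration 𝒜
  zero : 𝒜 0 = {Set.Ico 0 1}
  split : ∀ n, ∃ a c b : ℝ, a < c ∧ c < b ∧ Set.Ico a b ∈ 𝒜 n ∧
    children 𝒜 n (Set.Ico a b) = {Set.Ico a c, Set.Ico c b} ∧
    ∀ B ∈ 𝒜 n, B ≠ Set.Ico a b → children 𝒜 n B = {B}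
  mesh : Tendsto (fun n => ⨆ A ∈ 𝒜 n, volume A) atTop (𝓝 0)

/-- A generalized Haar system: an `L²`-normalized martingale difference based on a filtration as
above. -/
def IsGeneralizedHaarSystem (f : ℕ → ℝ → ℝ) : Prop :=
  ∃ 𝒜 : ℕ → Set (Set ℝ), IsHaarFiltration 𝒜 ∧ IsMartingaleDifference 𝒜 f ∧
    ∀ n, eLpNorm (f n) 2 unitMeasure = 1

/-- Orthonormal systems of real functions in `L²(0,1)`. -/
structure IsOrthonormalSystem (φ : ℕ → ℝ → ℝ) : Prop where
  memLp : ∀ n, MemLp (φ n) 2 unitMeasure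
  norm_eq_one : ∀ n, ∫ x, φ n x ^ 2 ∂unitMeasure = 1
  orthogonal : ∀ m n, m ≠ n → ∫ x, φ m x * φ n x ∂unitMeasure = 0

/-- `ω` is an a.e. convergence Weyl multiplier (C-multiplier) for the orthonormal system `φ`:
`ω` is nonnegative and increases to infinity, and `∑ aₙ φₙ` converges a.e. on `[0,1)` whenever
`∑ aₙ² ωₙ < ∞`. (Nonnegativity, rather than positivity, admits `log n`, which vanishes at its first
term.) -/
structure IsCMultiplier (ω : ℕ → ℝ) (φ : ℕ → ℝ → ℝ) : Prop where
  orthonormal : IsOrthonormalSystem φ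
  nonneg : ∀ n, 0 ≤ ω n
  monotone : Monotone ω
  tendsto_atTop : Tendsto ω atTop atTop
  ae_convergent : ∀ a : ℕ → ℝ, Summable (fun n => a n ^ 2 * ω n) →
    ∀ᵐ x ∂unitMeasure, ∃ s : ℝ,
      Tendsto (fun N => ∑ n ∈ Finset.range N, a n * φ n x) atTop (𝓝 s)

end GenHaar

namespace GenHaar

/-! ### Auxiliary real-variable facts -/

/-! A permutation destroys the martingale structure of the partial sums, so the proof uses a bound
that depends only on the set of indices summed. For a finite set, let `S` be the sum of the terms `a
n * f (σ n)` and `Q` the sum of `a n ^ 2` times (`f (σ n) ^ 2` plus its conditional second moment).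
Taken in the original order, `exp (t S - t² Q)` is a supermartingale, so its mean is at most `2` for
every `t` and every finite set (`integral_exp_sum_le`, `integral_expSum_le`).

Cut the series into blocks `[2 ^ 2 ^ k, 2 ^ 2 ^ (k + 1))`, on which the weight is comparable to `2 ^
k`. A block has at most `exp (2 * 2 ^ k)` initial sums, so a union bound with `t = ±L * 2 ^ k` and
Borel–Cantelli give, a.e. and eventually in `k`, `|S| ≤ 4 / L + L * 2 ^ k * Q` for all of them
(`ae_eventually_expSum_le`). The hypothesis makes `∑ 2 ^ k * Q` over full blocks integrable, so the
second term tends to `0`, and `L` is arbitrary. The sums over full blocks are absolutely summable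
a.e. by orthogonality, and `exists_tendsto_of_blocks` combines the two facts. -/

lemma exp_sub_sq_le (x : ℝ) : Real.exp (x - x ^ 2) ≤ 1 + x + x ^ 2 := by
  have h1 : 0 < 1 - x + x ^ 2 := by nlinarith [sq_nonneg (x - 1 / 2)]
  have h2 : 1 - x + x ^ 2 ≤ Real.exp (-(x - x ^ 2)) := by
    have := Real.one_sub_le_exp_neg (x - x ^ 2)
    linarith
  rw [Real.exp_neg] at h2
  have h3 := Real.exp_pos (x - x ^ 2)
  have h4 : (1 - x + x ^ 2) * Real.exp (x - x ^ 2) ≤ 1 := by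
    calc _ ≤ (Real.exp (x - x ^ 2))⁻¹ * Real.exp (x - x ^ 2) := by gcongr
      _ = 1 := inv_mul_cancel₀ h3.ne'
  -- The product equals `1 + x ^ 2 + x ^ 4`.
  have h5 : 1 ≤ (1 - x + x ^ 2) * (1 + x + x ^ 2) := by nlinarith [sq_nonneg x, sq_nonneg (x ^ 2)]
  exact le_of_mul_le_mul_left (h4.trans h5) h1

/-- Convergence of a series from control of its doubly exponential blocks. -/
lemma exists_tendsto_of_blocks (c : ℕ → ℝ)
    (hD : Summable fun k : ℕ =>
      (2 : ℝ) ^ k * (∑ n ∈ Finset.Ico (2 ^ 2 ^ k) (2 ^ 2 ^ (k + 1)), c n) ^ 2)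
    (hmax : ∀ ε > 0, ∀ᶠ k : ℕ in atTop, ∀ m ∈ Finset.Ico (2 ^ 2 ^ k) (2 ^ 2 ^ (k + 1)),
      |∑ n ∈ Finset.Ico (2 ^ 2 ^ k) m, c n| ≤ ε) :
    ∃ s : ℝ, Tendsto (fun N => ∑ n ∈ Finset.range N, c n) atTop (𝓝 s) := by
  set D : ℕ → ℝ := fun k => ∑ n ∈ Finset.Ico (2 ^ 2 ^ k) (2 ^ 2 ^ (k + 1)), c n with hDdef
  have hsum : Summable D := by
    have hgeo : Summable fun k : ℕ => ((1 : ℝ) / 2) ^ k := summable_geometric_two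
    refine Summable.of_norm_bounded ((hD.add hgeo).div_const 2) fun k => ?_
    have hk : (0 : ℝ) < 2 ^ k := by positivity
    have h1 : ((1 : ℝ) / 2) ^ k = (2 ^ k)⁻¹ := by rw [one_div, inv_pow]
    rw [h1, Real.norm_eq_abs]
    change |D k| ≤ (2 ^ k * D k ^ 2 + (2 ^ k)⁻¹) / 2
    rw [← sq_abs (D k)]
    -- AM-GM: `2 |D k| ≤ 2 ^ k * D k ^ 2 + 2 ^ (-k)`, and both terms on the right are summable.
    have h2 : 0 ≤ (2 ^ k)⁻¹ * (2 ^ k * |D k| - 1) ^ 2 := by positivity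
    have h3 : (2 ^ k)⁻¹ * (2 ^ k * |D k| - 1) ^ 2
        = 2 ^ k * |D k| ^ 2 - 2 * |D k| + (2 ^ k : ℝ)⁻¹ := by
      field_simp
      ring
    linarith
  have hmono : ∀ k : ℕ, 2 ^ 2 ^ k ≤ 2 ^ 2 ^ (k + 1) := fun k =>
    Nat.pow_le_pow_right (by norm_num) (Nat.pow_le_pow_right (by norm_num) k.le_succ)
  -- The blocks start at `2 ^ 2 ^ 0 = 2`, which leaves the terms `0` and `1` apart.
  have htel : ∀ k : ℕ, ∑ n ∈ Finset.range (2 ^ 2 ^ k), c n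
      = ∑ n ∈ Finset.range 2, c n + ∑ j ∈ Finset.range k, D j := by
    intro k
    induction k with
    | zero => simp
    | succ k ih =>
      rw [Finset.sum_range_succ D, ← add_assoc, ← ih]
      exact (Finset.sum_range_add_sum_Ico c (hmono k)).symm
  refine ⟨∑ n ∈ Finset.range 2, c n + ∑' j, D j, ?_⟩
  have hlim : Tendsto (fun k : ℕ => ∑ n ∈ Finset.range (2 ^ 2 ^ k), c n) atTop
      (𝓝 (∑ n ∈ Finset.range 2, c n + ∑' j, D j)) := by
    simp_rw [htel]
    exact hsum.hasSum.tendsto_sum_nat.const_add _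
  rw [Metric.tendsto_atTop]
  intro ε hε
  obtain ⟨K₁, hK₁⟩ := Metric.tendsto_atTop.1 hlim (ε / 2) (half_pos hε)
  obtain ⟨K₂, hK₂⟩ := eventually_atTop.1 (hmax (ε / 3) (by positivity))
  refine ⟨2 ^ 2 ^ (max K₁ K₂), fun n hn => ?_⟩
  have hn0 : n ≠ 0 := (lt_of_lt_of_le (by positivity) hn).ne'
  have hlog : 2 ^ max K₁ K₂ ≤ Nat.log 2 n := Nat.le_log_of_pow_le one_lt_two hn
  have hlog0 : Nat.log 2 n ≠ 0 := (lt_of_lt_of_le (by positivity) hlog).ne'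
  set k := Nat.log 2 (Nat.log 2 n) with hk
  have hkK : max K₁ K₂ ≤ k := Nat.le_log_of_pow_le one_lt_two hlog
  have hlow : 2 ^ 2 ^ k ≤ n :=
    (Nat.pow_le_pow_right (by norm_num) (Nat.pow_log_le_self 2 hlog0)).trans
      (Nat.pow_log_le_self 2 hn0)
  have hup : n < 2 ^ 2 ^ (k + 1) :=
    (Nat.lt_pow_succ_log_self one_lt_two n).trans_le
      (Nat.pow_le_pow_right (by norm_num) (Nat.lt_pow_succ_log_self one_lt_two _))
  have e1 := hK₁ k (le_of_max_le_left hkK)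
  have e2 := hK₂ k (le_of_max_le_right hkK) n (Finset.mem_Ico.2 ⟨hlow, hup⟩)
  rw [← Finset.sum_range_add_sum_Ico c hlow]
  rw [Real.dist_eq] at e1 ⊢
  rw [abs_lt] at e1 ⊢
  rw [abs_le] at e2
  constructor <;> linarith [e1.1, e1.2, e2.1, e2.2]

/-- Block form of the condition `∑ aₙ² log₂ (n + 1) < ∞`. -/
lemma summable_block_sq (a : ℕ → ℝ)
    (ha : Summable fun n : ℕ => a n ^ 2 * Real.logb 2 ((n : ℝ) + 1)) :
    Summable fun k : ℕ =>
      (2 : ℝ) ^ k * ∑ n ∈ Finset.Ico (2 ^ 2 ^ k) (2 ^ 2 ^ (k + 1)), a n ^ 2 := by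
  set w : ℕ → ℝ := fun n => a n ^ 2 * Real.logb 2 ((n : ℝ) + 1) with hw
  have hw0 : ∀ n, 0 ≤ w n := fun n =>
    mul_nonneg (sq_nonneg _) (Real.logb_nonneg one_lt_two (by
      have : (0 : ℝ) ≤ n := n.cast_nonneg
      linarith))
  have hmono : ∀ k : ℕ, 2 ^ 2 ^ k ≤ 2 ^ 2 ^ (k + 1) := fun k =>
    Nat.pow_le_pow_right (by norm_num) (Nat.pow_le_pow_right (by norm_num) k.le_succ)
  refine summable_of_sum_range_le (c := ∑' n, w n)
    (fun k => mul_nonneg (by positivity) (Finset.sum_nonneg fun _ _ => sq_nonneg _)) fun K => ?_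
  have hblock : ∀ k : ℕ, (2 : ℝ) ^ k * ∑ n ∈ Finset.Ico (2 ^ 2 ^ k) (2 ^ 2 ^ (k + 1)), a n ^ 2
      ≤ ∑ n ∈ Finset.Ico (2 ^ 2 ^ k) (2 ^ 2 ^ (k + 1)), w n := by
    intro k
    rw [Finset.mul_sum]
    refine Finset.sum_le_sum fun n hn => ?_
    rw [hw, mul_comm]
    refine mul_le_mul_of_nonneg_left ?_ (sq_nonneg _)
    have hn' : ((2 : ℝ) ^ 2 ^ k) ≤ (n : ℝ) + 1 := by
      have : ((2 ^ 2 ^ k : ℕ) : ℝ) ≤ n := Nat.cast_le.2 (Finset.mem_Ico.1 hn).1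
      push_cast at this
      linarith
    rw [Real.le_logb_iff_rpow_le one_lt_two (by positivity)]
    calc (2 : ℝ) ^ ((2 : ℝ) ^ k) = (2 : ℝ) ^ (((2 ^ k : ℕ) : ℝ)) := by push_cast; rfl
      _ = 2 ^ 2 ^ k := Real.rpow_natCast _ _
      _ ≤ _ := hn'
  have htel : ∀ K : ℕ, ∑ k ∈ Finset.range K, ∑ n ∈ Finset.Ico (2 ^ 2 ^ k) (2 ^ 2 ^ (k + 1)), w n
      ≤ ∑ n ∈ Finset.range (2 ^ 2 ^ K), w n := by
    intro K
    induction K with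
    | zero => simpa using Finset.sum_nonneg fun n _ => hw0 n
    | succ K ih =>
      rw [Finset.sum_range_succ, ← Finset.sum_range_add_sum_Ico w (hmono K)]
      gcongr
  exact (Finset.sum_le_sum fun k _ => hblock k).trans
    ((htel K).trans (ha.sum_le_tsum _ fun n _ => hw0 n))

lemma ae_summable_of_summable_integral {Ω : Type*} [MeasurableSpace Ω] {μ : Measure Ω}
    {g : ℕ → Ω → ℝ} (h0 : ∀ n x, 0 ≤ g n x) (hg : ∀ n, Integrable (g n) μ)
    (hs : Summable fun n => ∫ x, g n x ∂μ) : ∀ᵐ x ∂μ, Summable fun n => g n x := by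
  have hmeas : ∀ n, AEMeasurable (fun x => ENNReal.ofReal (g n x)) μ := fun n =>
    (hg n).aestronglyMeasurable.aemeasurable.ennreal_ofReal
  have hfin : ∫⁻ x, ∑' n, ENNReal.ofReal (g n x) ∂μ ≠ ⊤ := by
    rw [lintegral_tsum hmeas]
    have : ∀ n, ∫⁻ x, ENNReal.ofReal (g n x) ∂μ = ENNReal.ofReal (∫ x, g n x ∂μ) := fun n =>
      (ofReal_integral_eq_lintegral_ofReal (hg n) (ae_of_all _ (h0 n))).symm
    simp_rw [this]
    rw [← ENNReal.ofReal_tsum_of_nonneg (fun n => integral_nonneg (h0 n)) hs]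
    exact ENNReal.ofReal_ne_top
  filter_upwards [ae_lt_top' (AEMeasurable.tsum hmeas) hfin] with x hx
  have := ENNReal.summable_toReal hx.ne
  simpa [ENNReal.toReal_ofReal (h0 _ x)] using this

/-! ### Systems of functions living on successively split sets -/

/-- The conditional second moments of a system `f` for which `f (n + 1)` is supported on `A n` and
has unit `L²` norm. -/
noncomputable def condSq {Ω : Type*} [MeasurableSpace Ω] (μ : Measure Ω) (A : ℕ → Set Ω) :
    ℕ → Ω → ℝ
  | 0 => fun _ => 0
  | n + 1 => (A n).indicator fun _ => (μ.real (A n))⁻¹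

/-- An `L²`-normalized system in which `f (n + 1)` is supported on `A n`, has zero integral there,
and the earlier functions are constant on `A n`. -/
structure IsSplittingSystem {Ω : Type*} [MeasurableSpace Ω] (μ : Measure Ω) (A : ℕ → Set Ω)
    (f : ℕ → Ω → ℝ) : Prop where
  measurableSet : ∀ n, MeasurableSet (A n)
  pos : ∀ n, 0 < μ.real (A n)
  nested : ∀ m n, m < n → A n ⊆ A m ∨ Disjoint (A n) (A m)
  memLp : ∀ n, MemLp (f n) 2 μ
  supp : ∀ n, ∀ᵐ x ∂μ, x ∉ A n → f (n + 1) x = 0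
  const_on : ∀ m n, m ≤ n → ∃ c, ∀ x ∈ A n, f m x = c
  integral_eq_zero : ∀ n, ∫ x in A n, f (n + 1) x ∂μ = 0
  integral_sq : ∀ n, ∫ x, f n x ^ 2 ∂μ = 1

namespace IsSplittingSystem

variable {Ω : Type*} [MeasurableSpace Ω] {μ : Measure Ω} {A : ℕ → Set Ω} {f : ℕ → Ω → ℝ}

lemma condSq_nonneg (n : ℕ) (x : Ω) : 0 ≤ condSq μ A n x := by
  cases n with
  | zero => exact le_rfl
  | succ n => exact Set.indicator_nonneg (fun _ _ => inv_nonneg.2 measureReal_nonneg) x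

lemma measurable_condSq (h : IsSplittingSystem μ A f) (n : ℕ) : Measurable (condSq μ A n) := by
  cases n with
  | zero => exact measurable_const
  | succ n => exact measurable_const.indicator (h.measurableSet n)

lemma integrable_condSq [IsFiniteMeasure μ] (h : IsSplittingSystem μ A f) (n : ℕ) :
    Integrable (condSq μ A n) μ := by
  cases n with
  | zero => exact integrable_zero _ _ _
  | succ n => exact (integrable_const _).indicator (h.measurableSet n)

lemma integral_condSq_le (h : IsSplittingSystem μ A f) (n : ℕ) : ∫ x, condSq μ A n x ∂μ ≤ 1 := by
  cases n with
  | zero => simp [condSq]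
  | succ n =>
    simp only [condSq]
    rw [integral_indicator (h.measurableSet n), setIntegral_const, smul_eq_mul,
      mul_inv_cancel₀ (h.pos n).ne']

lemma condSq_const (h : IsSplittingSystem μ A f) (m n : ℕ) (hmn : m ≤ n) :
    ∃ c, ∀ x ∈ A n, condSq μ A m x = c := by
  cases m with
  | zero => exact ⟨0, fun _ _ => rfl⟩
  | succ m =>
    rcases h.nested m n hmn with hs | hd
    · exact ⟨(μ.real (A m))⁻¹, fun x hx => by simp [condSq, hs hx]⟩
    · exact ⟨0, fun x hx => by simp [condSq, Set.disjoint_left.1 hd hx]⟩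

lemma integrable_sq (h : IsSplittingSystem μ A f) (n : ℕ) : Integrable (fun x => f n x ^ 2) μ :=
  (memLp_two_iff_integrable_sq (h.memLp n).aestronglyMeasurable).1 (h.memLp n)

/-- The later function lives on a set where the earlier one is constant, and has zero integral
there. -/
lemma orthogonal_of_lt (h : IsSplittingSystem μ A f) {m n : ℕ} (hmn : m < n) :
    ∫ x, f m x * f n x ∂μ = 0 := by
  obtain ⟨n, rfl⟩ : ∃ k, n = k + 1 := ⟨n - 1, by omega⟩
  obtain ⟨c, hc⟩ := h.const_on m n (by omega)
  have h1 : ∫ x, f m x * f (n + 1) x ∂μ = ∫ x in A n, f m x * f (n + 1) x ∂μ := by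
    refine (setIntegral_eq_integral_of_ae_compl_eq_zero ?_).symm
    filter_upwards [h.supp n] with x hx hxA
    rw [hx hxA, mul_zero]
  rw [h1, setIntegral_congr_fun (h.measurableSet n) (g := fun x => c * f (n + 1) x)
    (fun x hx => by simp only [hc x hx]), integral_const_mul, h.integral_eq_zero, mul_zero]

lemma orthogonal (h : IsSplittingSystem μ A f) (m n : ℕ) (hmn : m ≠ n) :
    ∫ x, f m x * f n x ∂μ = 0 := by
  rcases lt_or_gt_of_ne hmn with hlt | hlt
  · exact h.orthogonal_of_lt hlt
  · simpa only [mul_comm] using h.orthogonal_of_lt hlt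

lemma integral_sum_sq (h : IsSplittingSystem μ A f) (s : Finset ℕ) (b : ℕ → ℝ) :
    ∫ x, (∑ j ∈ s, b j * f j x) ^ 2 ∂μ = ∑ j ∈ s, b j ^ 2 := by
  have hint : ∀ i j, Integrable (fun x => b i * f i x * (b j * f j x)) μ := fun i j => by
    have := ((h.memLp i).integrable_mul (h.memLp j)).const_mul (b i * b j)
    refine this.congr (ae_of_all _ fun x => ?_)
    simp only [Pi.mul_apply]
    ring
  have hval : ∀ i j, ∫ x, b i * f i x * (b j * f j x) ∂μ = if i = j then b i ^ 2 else 0 := by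
    intro i j
    have : ∀ x, b i * f i x * (b j * f j x) = b i * b j * (f i x * f j x) := fun x => by ring
    simp_rw [this]
    rw [integral_const_mul]
    split_ifs with hij
    · subst hij
      simp_rw [← pow_two]
      rw [h.integral_sq, mul_one]
    · rw [h.orthogonal i j hij, mul_zero]
  simp_rw [pow_two, Finset.sum_mul_sum]
  rw [integral_finsetSum _ fun i _ => integrable_finsetSum _ fun j _ => hint i j]
  refine Finset.sum_congr rfl fun i hi => ?_
  rw [integral_finsetSum _ fun j _ => hint i j]
  simp_rw [hval]
  simp [hi, pow_two]

/-! ### The exponential supermartingale. -/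

/-- The exponent of one step of the exponential supermartingale. -/
noncomputable def expTerm (μ : Measure Ω) (A : ℕ → Set Ω) (f : ℕ → Ω → ℝ) (u : ℕ → ℝ) (j : ℕ)
    (x : Ω) : ℝ :=
  u j * f j x - u j ^ 2 * (f j x ^ 2 + condSq μ A j x)

lemma expTerm_le (u : ℕ → ℝ) (j : ℕ) (x : Ω) : expTerm μ A f u j x ≤ 1 / 4 := by
  have := mul_nonneg (sq_nonneg (u j)) (condSq_nonneg (μ := μ) (A := A) j x)
  rw [expTerm]
  nlinarith [sq_nonneg (u j * f j x - 1 / 2)]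

lemma integrable_exp_sum [IsFiniteMeasure μ] (h : IsSplittingSystem μ A f) (u : ℕ → ℝ)
    (s : Finset ℕ) : Integrable (fun x => Real.exp (∑ j ∈ s, expTerm μ A f u j x)) μ := by
  have hmeas : ∀ j, AEStronglyMeasurable (expTerm μ A f u j) μ := fun j =>
    (((h.memLp j).aestronglyMeasurable.const_mul (u j))).sub
      ((((h.memLp j).aestronglyMeasurable.pow 2).add
        (h.measurable_condSq j).aestronglyMeasurable).const_mul (u j ^ 2))
  refine Integrable.of_bound (C := Real.exp (∑ _j ∈ s, 1 / 4))
    (Real.continuous_exp.comp_aestronglyMeasurable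
      (Finset.aestronglyMeasurable_fun_sum s fun j _ => hmeas j)) (ae_of_all _ fun x => ?_)
  rw [Real.norm_eq_abs, Real.abs_exp]
  exact Real.exp_le_exp.2 (Finset.sum_le_sum fun j _ => expTerm_le u j x)

/-- One supermartingale step. With `p` the measure of `A n`, `exp_sub_sq_le` and the zero mean
reduce the integral to `exp (-t² / p) * (p + t²)`, and `1 + y ≤ exp y` at `y = t² / p` concludes.
The conditional moment `1 / p` in the exponent is exactly what compensates the quadratic term. -/
lemma setIntegral_exp_expTerm_le [IsFiniteMeasure μ] (h : IsSplittingSystem μ A f) (u : ℕ → ℝ)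
    (n : ℕ) : ∫ x in A n, Real.exp (expTerm μ A f u (n + 1) x) ∂μ ≤ μ.real (A n) := by
  set p := μ.real (A n) with hp
  have hp0 : 0 < p := h.pos n
  set t := u (n + 1) with ht
  have hint : Integrable (fun x => 1 + t * f (n + 1) x + t ^ 2 * f (n + 1) x ^ 2)
      (μ.restrict (A n)) :=
    (((integrable_const 1).add (((h.memLp _).integrable one_le_two).const_mul t)).add
      ((h.integrable_sq _).const_mul (t ^ 2))).restrict
  have hpt : ∀ x ∈ A n, Real.exp (expTerm μ A f u (n + 1) x)
      ≤ Real.exp (-(t ^ 2 / p)) * (1 + t * f (n + 1) x + t ^ 2 * f (n + 1) x ^ 2) := by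
    intro x hx
    have e1 : expTerm μ A f u (n + 1) x
        = -(t ^ 2 / p) + (t * f (n + 1) x - (t * f (n + 1) x) ^ 2) := by
      simp only [expTerm, condSq, Set.indicator_of_mem hx, ← hp, ← ht]
      ring
    rw [e1, Real.exp_add, ← mul_pow]
    exact mul_le_mul_of_nonneg_left (exp_sub_sq_le _) (Real.exp_pos _).le
  have hsq : ∫ x in A n, f (n + 1) x ^ 2 ∂μ = 1 := by
    rw [← h.integral_sq (n + 1)]
    refine setIntegral_eq_integral_of_ae_compl_eq_zero ?_
    filter_upwards [h.supp n] with x hx hxA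
    rw [hx hxA]
    norm_num
  have hexp : Integrable (fun x => Real.exp (expTerm μ A f u (n + 1) x)) μ := by
    simpa using h.integrable_exp_sum u {n + 1}
  calc ∫ x in A n, Real.exp (expTerm μ A f u (n + 1) x) ∂μ
      ≤ ∫ x in A n, Real.exp (-(t ^ 2 / p))
          * (1 + t * f (n + 1) x + t ^ 2 * f (n + 1) x ^ 2) ∂μ :=
        setIntegral_mono_on hexp.restrict (hint.const_mul _) (h.measurableSet n) hpt
    _ = Real.exp (-(t ^ 2 / p)) * (p + t ^ 2) := by
        have i1 : Integrable (fun x => t * f (n + 1) x) (μ.restrict (A n)) :=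
          (((h.memLp _).integrable one_le_two).const_mul t).restrict
        have i2 : Integrable (fun x => t ^ 2 * f (n + 1) x ^ 2) (μ.restrict (A n)) :=
          ((h.integrable_sq _).const_mul (t ^ 2)).restrict
        have i3 : Integrable (fun x => 1 + t * f (n + 1) x) (μ.restrict (A n)) :=
          (integrable_const 1).add i1
        rw [integral_const_mul, integral_add i3 i2, integral_add (integrable_const 1) i1,
          integral_const_mul, integral_const_mul,
          h.integral_eq_zero, hsq, setIntegral_const]
        simp [hp]
    _ ≤ Real.exp (-(t ^ 2 / p)) * (p * Real.exp (t ^ 2 / p)) := by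
        refine mul_le_mul_of_nonneg_left ?_ (Real.exp_pos _).le
        have := Real.add_one_le_exp (t ^ 2 / p)
        calc p + t ^ 2 = p * (t ^ 2 / p + 1) := by field_simp; ring
          _ ≤ _ := by gcongr
    _ = p := by
        rw [mul_left_comm, ← Real.exp_add, neg_add_cancel, Real.exp_zero, mul_one]

lemma integral_exp_sum_range_le [IsProbabilityMeasure μ] (h : IsSplittingSystem μ A f)
    (u : ℕ → ℝ) (n : ℕ) :
    ∫ x, Real.exp (∑ j ∈ Finset.range (n + 1), expTerm μ A f u j x) ∂μ ≤ Real.exp (1 / 4) := by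
  induction n with
  | zero =>
    -- No mean is assumed for `f 0` and `condSq` is `0` there; the pointwise bound on the exponent
    -- is the source of `exp (1 / 4)`.
    calc _ ≤ ∫ _, Real.exp (1 / 4) ∂μ :=
          integral_mono (h.integrable_exp_sum u _) (integrable_const _) fun x => by
            simpa using expTerm_le (μ := μ) (A := A) (f := f) u 0 x
      _ = _ := by simp
  | succ n ih =>
    refine le_trans ?_ ih
    have hA := h.measurableSet n
    rw [← integral_add_compl hA (h.integrable_exp_sum u (Finset.range (n + 1 + 1))),
      ← integral_add_compl hA (h.integrable_exp_sum u (Finset.range (n + 1)))]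
    -- On `A n` the earlier exponents are constant and factor out; off `A n` the new exponent
    -- vanishes a.e.
    refine add_le_add ?_ (le_of_eq ?_)
    · have hconst : ∀ j, ∃ c, j ∈ Finset.range (n + 1) → ∀ x ∈ A n, expTerm μ A f u j x = c := by
        intro j
        by_cases hj : j ≤ n
        · obtain ⟨c, hc⟩ := h.const_on j n hj
          obtain ⟨d, hd⟩ := h.condSq_const j n hj
          exact ⟨u j * c - u j ^ 2 * (c ^ 2 + d), fun _ x hx => by
            rw [expTerm, hc x hx, hd x hx]⟩
        · exact ⟨0, fun hj' => absurd (Nat.lt_succ_iff.1 (Finset.mem_range.1 hj')) hj⟩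
      choose c hc using hconst
      set z := Real.exp (∑ j ∈ Finset.range (n + 1), c j) with hz
      have hzx : ∀ x ∈ A n, Real.exp (∑ j ∈ Finset.range (n + 1), expTerm μ A f u j x) = z :=
        fun x hx => by rw [hz, Finset.sum_congr rfl fun j hj => hc j hj x hx]
      rw [setIntegral_congr_fun hA (g := fun _ => z) hzx,
        setIntegral_congr_fun hA (g := fun x => z * Real.exp (expTerm μ A f u (n + 1) x))
          (fun x hx => by
            simp only
            rw [Finset.sum_range_succ, Real.exp_add, hzx x hx]),
        integral_const_mul, setIntegral_const, smul_eq_mul, mul_comm _ z]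
      exact mul_le_mul_of_nonneg_left (h.setIntegral_exp_expTerm_le u n) (Real.exp_pos _).le
    · refine setIntegral_congr_ae hA.compl ?_
      filter_upwards [h.supp n] with x hx hxA
      have : expTerm μ A f u (n + 1) x = 0 := by
        simp [expTerm, hx hxA, condSq, Set.indicator_of_notMem hxA]
      rw [Finset.sum_range_succ, this, add_zero]

/-- Setting the coefficients outside `s` to zero reduces any finite set to an initial segment; this
is what makes the bound insensitive to rearrangement. -/
lemma integral_exp_sum_le [IsProbabilityMeasure μ] (h : IsSplittingSystem μ A f)
    (u : ℕ → ℝ) (s : Finset ℕ) :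
    ∫ x, Real.exp (∑ j ∈ s, expTerm μ A f u j x) ∂μ ≤ Real.exp (1 / 4) := by
  obtain ⟨n, hn⟩ := s.exists_nat_subset_range
  have hn' : s ⊆ Finset.range (n + 1) := hn.trans (Finset.range_mono n.le_succ)
  refine le_trans (le_of_eq ?_) (h.integral_exp_sum_range_le (fun j => if j ∈ s then u j else 0) n)
  refine integral_congr_ae (ae_of_all _ fun x => ?_)
  simp only
  rw [← Finset.sum_subset hn' fun j _ hj => by simp [expTerm, hj]]
  congr 1
  exact Finset.sum_congr rfl fun j hj => by simp [expTerm, hj]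

end IsSplittingSystem
end GenHaar

/-! ### Rearranged sums: maximal bound over blocks and a.e. convergence. -/

namespace GenHaar
namespace IsSplittingSystem

variable {Ω : Type*} [MeasurableSpace Ω] {μ : Measure Ω} {A : ℕ → Set Ω} {f : ℕ → Ω → ℝ}

/-- The exponential of a partial sum of the rearranged series with parameter `t`. -/
noncomputable def expSum (μ : Measure Ω) (A : ℕ → Set Ω) (f : ℕ → Ω → ℝ) (σ : Equiv.Perm ℕ)
    (a : ℕ → ℝ) (t : ℝ) (s : Finset ℕ) (x : Ω) : ℝ :=
  Real.exp (t * ∑ n ∈ s, a n * f (σ n) x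
    - t ^ 2 * ∑ n ∈ s, a n ^ 2 * (f (σ n) x ^ 2 + condSq μ A (σ n) x))

lemma expSum_eq (σ : Equiv.Perm ℕ) (a : ℕ → ℝ) (t : ℝ) (s : Finset ℕ) (x : Ω) :
    expSum μ A f σ a t s x
      = Real.exp (∑ j ∈ s.map σ.toEmbedding, expTerm μ A f (fun j => t * a (σ.symm j)) j x) := by
  rw [expSum, Finset.sum_map, Finset.mul_sum, Finset.mul_sum, ← Finset.sum_sub_distrib]
  congr 1
  refine Finset.sum_congr rfl fun n _ => ?_
  simp only [expTerm, Equiv.coe_toEmbedding, Equiv.symm_apply_apply]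
  ring

lemma integrable_expSum [IsFiniteMeasure μ] (h : IsSplittingSystem μ A f) (σ : Equiv.Perm ℕ)
    (a : ℕ → ℝ) (t : ℝ) (s : Finset ℕ) : Integrable (expSum μ A f σ a t s) μ :=
  (h.integrable_exp_sum (fun j => t * a (σ.symm j)) (s.map σ.toEmbedding)).congr
    (ae_of_all _ fun x => (expSum_eq σ a t s x).symm)

lemma integral_expSum_le [IsProbabilityMeasure μ] (h : IsSplittingSystem μ A f)
    (σ : Equiv.Perm ℕ) (a : ℕ → ℝ) (t : ℝ) (s : Finset ℕ) :
    ∫ x, expSum μ A f σ a t s x ∂μ ≤ 2 := by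
  simp_rw [expSum_eq]
  refine (h.integral_exp_sum_le _ _).trans ?_
  have h1 := Real.add_one_le_exp (-(1 / 4 : ℝ))
  have h2 : Real.exp (1 / 4) * Real.exp (-(1 / 4)) = 1 := by
    rw [← Real.exp_add, add_neg_cancel, Real.exp_zero]
  nlinarith [Real.exp_pos (1 / 4 : ℝ)]

/-- For every parameter `L`, the exponentials with parameter `±L 2ᵏ` of all partial sums of the
`k`-th block are eventually at most `exp (4 · 2ᵏ)`. -/
lemma ae_eventually_expSum_le [IsProbabilityMeasure μ] (h : IsSplittingSystem μ A f)
    (σ : Equiv.Perm ℕ) (a : ℕ → ℝ) (L : ℝ) :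
    ∀ᵐ x ∂μ, ∀ᶠ k : ℕ in atTop, ∀ m ∈ Finset.Ico (2 ^ 2 ^ k) (2 ^ 2 ^ (k + 1)),
      expSum μ A f σ a (L * 2 ^ k) (Finset.Ico (2 ^ 2 ^ k) m) x ≤ Real.exp (4 * 2 ^ k) := by
  set g : ℕ → Ω → ℝ := fun k x => Real.exp (-(4 * 2 ^ k)) *
    ∑ m ∈ Finset.Ico (2 ^ 2 ^ k) (2 ^ 2 ^ (k + 1)),
      expSum μ A f σ a (L * 2 ^ k) (Finset.Ico (2 ^ 2 ^ k) m) x with hg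
  have hE0 : ∀ t s x, 0 ≤ expSum μ A f σ a t s x := fun _ _ _ => (Real.exp_pos _).le
  have hg0 : ∀ k x, 0 ≤ g k x := fun k x =>
    mul_nonneg (Real.exp_pos _).le (Finset.sum_nonneg fun _ _ => hE0 _ _ _)
  have hgi : ∀ k, Integrable (g k) μ := fun k =>
    (integrable_finsetSum _ fun m _ => h.integrable_expSum σ a _ _).const_mul _
  -- At most `exp (2 * 2 ^ k)` summands of mean at most `2`, against the factor `exp (-(4 * 2 ^
  -- k))`: a summable bound, as Borel–Cantelli needs.
  have hgint : ∀ k, ∫ x, g k x ∂μ ≤ 2 * (1 / 2) ^ k := by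
    intro k
    simp only [hg]
    rw [integral_const_mul, integral_finsetSum _ fun m _ => h.integrable_expSum σ a _ _]
    have hcard : ((2 ^ 2 ^ (k + 1) : ℕ) : ℝ) ≤ Real.exp (2 * 2 ^ k) := by
      have h2 : (2 : ℝ) ≤ Real.exp 1 := by linarith [Real.add_one_le_exp (1 : ℝ)]
      calc ((2 ^ 2 ^ (k + 1) : ℕ) : ℝ) = 2 ^ 2 ^ (k + 1) := by push_cast; rfl
        _ ≤ Real.exp 1 ^ 2 ^ (k + 1) := by gcongr
        _ = Real.exp (2 * 2 ^ k) := by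
          rw [← Real.exp_nat_mul]
          congr 1
          push_cast
          ring
    have hinv : Real.exp (-(2 * 2 ^ k)) ≤ (1 / 2) ^ k := by
      rw [Real.exp_neg, one_div, inv_pow]
      refine inv_anti₀ (by positivity) ?_
      have : (0 : ℝ) < 2 ^ k := by positivity
      linarith [Real.add_one_le_exp (2 * 2 ^ k : ℝ)]
    calc _ ≤ Real.exp (-(4 * 2 ^ k)) *
          ∑ _m ∈ Finset.Ico (2 ^ 2 ^ k) (2 ^ 2 ^ (k + 1)), (2 : ℝ) := by
          refine mul_le_mul_of_nonneg_left ?_ (Real.exp_pos _).le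
          exact Finset.sum_le_sum fun m _ => h.integral_expSum_le σ a _ _
      _ ≤ Real.exp (-(4 * 2 ^ k)) * (Real.exp (2 * 2 ^ k) * 2) := by
          refine mul_le_mul_of_nonneg_left ?_ (Real.exp_pos _).le
          rw [Finset.sum_const, Nat.card_Ico, nsmul_eq_mul]
          refine mul_le_mul_of_nonneg_right (le_trans ?_ hcard) zero_le_two
          exact Nat.cast_le.2 (Nat.sub_le _ _)
      _ = 2 * Real.exp (-(2 * 2 ^ k)) := by
          rw [← mul_assoc, ← Real.exp_add, mul_comm]
          congr 2
          ring
      _ ≤ _ := by gcongr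
  have hsum : Summable fun k => ∫ x, g k x ∂μ :=
    Summable.of_nonneg_of_le (fun k => integral_nonneg (hg0 k)) hgint
      (summable_geometric_two.mul_left 2)
  filter_upwards [ae_summable_of_summable_integral hg0 hgi hsum] with x hx
  filter_upwards [hx.tendsto_atTop_zero.eventually (ge_mem_nhds zero_lt_one)] with k hk m hm
  have h1 : Real.exp (-(4 * 2 ^ k)) *
      expSum μ A f σ a (L * 2 ^ k) (Finset.Ico (2 ^ 2 ^ k) m) x ≤ 1 := by
    refine le_trans (mul_le_mul_of_nonneg_left ?_ (Real.exp_pos _).le) hk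
    exact Finset.single_le_sum (f := fun m =>
      expSum μ A f σ a (L * 2 ^ k) (Finset.Ico (2 ^ 2 ^ k) m) x) (fun _ _ => hE0 _ _ _) hm
  rw [Real.exp_neg] at h1
  rwa [inv_mul_le_iff₀ (Real.exp_pos _), mul_one] at h1

lemma integral_block_sq_le [IsProbabilityMeasure μ] (h : IsSplittingSystem μ A f)
    (σ : Equiv.Perm ℕ) (a : ℕ → ℝ) (s : Finset ℕ) :
    Integrable (fun x => ∑ n ∈ s, a n ^ 2 * (f (σ n) x ^ 2 + condSq μ A (σ n) x)) μ ∧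
    ∫ x, ∑ n ∈ s, a n ^ 2 * (f (σ n) x ^ 2 + condSq μ A (σ n) x) ∂μ
      ≤ 2 * ∑ n ∈ s, a n ^ 2 := by
  have hi : ∀ n, Integrable (fun x => a n ^ 2 * (f (σ n) x ^ 2 + condSq μ A (σ n) x)) μ :=
    fun n => ((h.integrable_sq _).add (h.integrable_condSq _)).const_mul _
  refine ⟨integrable_finsetSum _ fun n _ => hi n, ?_⟩
  rw [integral_finsetSum _ fun n _ => hi n, Finset.mul_sum]
  refine Finset.sum_le_sum fun n _ => ?_
  rw [integral_const_mul, integral_add (h.integrable_sq _) (h.integrable_condSq _), h.integral_sq,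
    mul_comm]
  exact mul_le_mul_of_nonneg_right (by linarith [h.integral_condSq_le (σ n)]) (sq_nonneg _)

theorem ae_exists_tendsto [IsProbabilityMeasure μ] (h : IsSplittingSystem μ A f)
    (σ : Equiv.Perm ℕ) (a : ℕ → ℝ)
    (ha : Summable fun n : ℕ => a n ^ 2 * Real.logb 2 ((n : ℝ) + 1)) :
    ∀ᵐ x ∂μ, ∃ s : ℝ,
      Tendsto (fun N => ∑ n ∈ Finset.range N, a n * f (σ n) x) atTop (𝓝 s) := by
  have hB := summable_block_sq a ha
  have hQ0 : ∀ (s : Finset ℕ) (x : Ω) (n : ℕ), n ∈ s →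
      0 ≤ a n ^ 2 * (f (σ n) x ^ 2 + condSq μ A (σ n) x) := fun s x n _ =>
    mul_nonneg (sq_nonneg _) (add_nonneg (sq_nonneg _) (condSq_nonneg _ _))
  have hD : ∀ᵐ x ∂μ, Summable fun k : ℕ => (2 : ℝ) ^ k *
      (∑ n ∈ Finset.Ico (2 ^ 2 ^ k) (2 ^ 2 ^ (k + 1)), a n * f (σ n) x) ^ 2 := by
    have hmap : ∀ (s : Finset ℕ) (x : Ω), ∑ n ∈ s, a n * f (σ n) x
        = ∑ j ∈ s.map σ.toEmbedding, a (σ.symm j) * f j x := fun s x => by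
      simp [Finset.sum_map]
    refine ae_summable_of_summable_integral (fun k x => by positivity) (fun k => ?_) ?_
    · simp_rw [hmap]
      exact (memLp_finsetSum _ fun j _ => (h.memLp j).const_mul _).integrable_sq.const_mul _
    · refine hB.congr fun k => ?_
      rw [integral_const_mul]
      simp_rw [hmap]
      rw [h.integral_sum_sq]
      simp [Finset.sum_map]
  have hQ : ∀ᵐ x ∂μ, Summable fun k : ℕ => (2 : ℝ) ^ k *
      ∑ n ∈ Finset.Ico (2 ^ 2 ^ k) (2 ^ 2 ^ (k + 1)),
        a n ^ 2 * (f (σ n) x ^ 2 + condSq μ A (σ n) x) := by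
    refine ae_summable_of_summable_integral
      (fun k x => mul_nonneg (by positivity) (Finset.sum_nonneg (hQ0 _ x)))
      (fun k => (h.integral_block_sq_le σ a _).1.const_mul _) ?_
    refine Summable.of_nonneg_of_le (fun k => integral_nonneg fun x =>
      mul_nonneg (by positivity) (Finset.sum_nonneg (hQ0 _ x))) (fun k => ?_) (hB.mul_left 2)
    rw [integral_const_mul, mul_left_comm]
    exact mul_le_mul_of_nonneg_left (h.integral_block_sq_le σ a _).2 (by positivity)
  -- Integer parameters are countably many, so one null set serves all `L`; both signs are needed to
  -- bound the absolute value.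
  have hE : ∀ᵐ x ∂μ, ∀ L : ℤ, ∀ᶠ k : ℕ in atTop,
      ∀ m ∈ Finset.Ico (2 ^ 2 ^ k) (2 ^ 2 ^ (k + 1)),
        expSum μ A f σ a (L * 2 ^ k) (Finset.Ico (2 ^ 2 ^ k) m) x ≤ Real.exp (4 * 2 ^ k) :=
    ae_all_iff.2 fun L => h.ae_eventually_expSum_le σ a L
  filter_upwards [hD, hQ, hE] with x hDx hQx hEx
  refine exists_tendsto_of_blocks (fun n => a n * f (σ n) x) hDx fun ε hε => ?_
  -- This makes `4 / L < ε / 2`; the other half of `ε` absorbs `L * 2 ^ k * Q`.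
  obtain ⟨L, hL⟩ := exists_nat_gt (8 / ε)
  have hL0 : (0 : ℝ) < L := lt_trans (by positivity) hL
  have hQL := (hQx.tendsto_atTop_zero.const_mul (L : ℝ)).eventually
    (ge_mem_nhds (show (L : ℝ) * 0 < ε / 2 by rw [mul_zero]; positivity))
  filter_upwards [hEx L, hEx (-L), hQL] with k hp hn hq m hm
  have hpm := hp m hm
  have hnm := hn m hm
  rw [expSum, Real.exp_le_exp] at hpm hnm
  push_cast at hpm hnm
  set T := ∑ n ∈ Finset.Ico (2 ^ 2 ^ k) m, a n * f (σ n) x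
  set q := ∑ n ∈ Finset.Ico (2 ^ 2 ^ k) m, a n ^ 2 * (f (σ n) x ^ 2 + condSq μ A (σ n) x)
  set Q := ∑ n ∈ Finset.Ico (2 ^ 2 ^ k) (2 ^ 2 ^ (k + 1)),
    a n ^ 2 * (f (σ n) x ^ 2 + condSq μ A (σ n) x)
  have hqQ : q ≤ Q := Finset.sum_le_sum_of_subset_of_nonneg
    (Finset.Ico_subset_Ico_right (Finset.mem_Ico.1 hm).2.le) fun n hn _ => hQ0 _ x n hn
  have hk : (0 : ℝ) < 2 ^ k := by positivity
  have h8 : 8 < ε * L := by rwa [div_lt_iff₀' hε] at hL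
  have hLk : (0 : ℝ) < L * 2 ^ k := by positivity
  have hq' : (L * 2 ^ k) ^ 2 * q ≤ L * 2 ^ k * (ε / 2) := by
    calc (L * 2 ^ k : ℝ) ^ 2 * q ≤ (L * 2 ^ k) ^ 2 * Q := by gcongr
      _ = L * 2 ^ k * (L * (2 ^ k * Q)) := by ring
      _ ≤ _ := by gcongr
  have h4 : 4 * 2 ^ k ≤ L * 2 ^ k * (ε / 2) := by nlinarith
  rw [abs_le]
  constructor
  · refine le_of_mul_le_mul_left ?_ hLk
    nlinarith
  · refine le_of_mul_le_mul_left ?_ hLk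
    nlinarith

end IsSplittingSystem
end GenHaar

/-! ### Generalized Haar systems as splitting systems. -/

namespace GenHaar

instance : IsProbabilityMeasure unitMeasure := ⟨by simp [unitMeasure]⟩

lemma IsPartition.eq_of_mem {P : Set (Set ℝ)} (hP : IsPartition P) {A B : Set ℝ} (hA : A ∈ P)
    (hB : B ∈ P) {x : ℝ} (hxA : x ∈ A) (hxB : x ∈ B) : A = B := by
  by_contra hne
  exact Set.disjoint_left.1 (hP.pairwiseDisjoint hA hB hne) hxA hxB

lemma IsPartition.subset_Ico {P : Set (Set ℝ)} (hP : IsPartition P) {A : Set ℝ} (hA : A ∈ P) :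
    A ⊆ Set.Ico 0 1 := hP.sUnion_eq ▸ Set.subset_sUnion_of_mem hA

lemma IsPartition.exists_mem {P : Set (Set ℝ)} (hP : IsPartition P) {x : ℝ}
    (hx : x ∈ Set.Ico (0 : ℝ) 1) : ∃ A ∈ P, x ∈ A := by
  rwa [← hP.sUnion_eq] at hx

lemma IsFiltration.exists_superset_succ {𝒜 : ℕ → Set (Set ℝ)} (h : IsFiltration 𝒜) {n : ℕ}
    {B : Set ℝ} (hB : B ∈ 𝒜 (n + 1)) : ∃ A ∈ 𝒜 n, B ⊆ A := by
  obtain ⟨x, hx⟩ := (h.isPartition (n + 1)).nonempty B hB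
  obtain ⟨A, hA, hxA⟩ :=
    (h.isPartition n).exists_mem ((h.isPartition (n + 1)).subset_Ico hB hx)
  obtain ⟨S, hS, rfl⟩ := h.union_of_next n A hA
  obtain ⟨C, hC, hxC⟩ := hxA
  have : B = C := (h.isPartition (n + 1)).eq_of_mem hB (hS hC) hx hxC
  exact ⟨_, hA, this ▸ Set.subset_sUnion_of_mem hC⟩

lemma IsFiltration.exists_superset {𝒜 : ℕ → Set (Set ℝ)} (h : IsFiltration 𝒜) {m n : ℕ}
    (hmn : m ≤ n) {B : Set ℝ} (hB : B ∈ 𝒜 n) : ∃ A ∈ 𝒜 m, B ⊆ A := by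
  induction n, hmn using Nat.le_induction generalizing B with
  | base => exact ⟨B, hB, subset_rfl⟩
  | succ n _ ih =>
    obtain ⟨C, hC, hBC⟩ := h.exists_superset_succ hB
    obtain ⟨A, hA, hCA⟩ := ih hC
    exact ⟨A, hA, hBC.trans hCA⟩

lemma IsHaarFiltration.volume_pos {𝒜 : ℕ → Set (Set ℝ)} (h : IsHaarFiltration 𝒜) {n : ℕ}
    {B : Set ℝ} (hB : B ∈ 𝒜 n) : 0 < volume B := by
  induction n generalizing B with
  | zero =>
    rw [h.zero] at hB
    rw [Set.mem_singleton_iff.1 hB]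
    simp
  | succ n ih =>
    obtain ⟨A, hA, hBA⟩ := h.isFiltration.exists_superset_succ hB
    have hch : B ∈ children 𝒜 n A := ⟨hB, hBA⟩
    obtain ⟨a, c, b, hac, hcb, -, hsplit, hkeep⟩ := h.split n
    by_cases hAa : A = Set.Ico a b
    · rw [hAa, hsplit] at hch
      rcases hch with rfl | rfl
      · simpa using hac
      · simpa using hcb
    · rw [hkeep A hA hAa] at hch
      rw [Set.mem_singleton_iff.1 hch]
      exact ih hA

/-- `A n` is the interval of `𝒜 n` that is split. On every other interval of `𝒜 n`, `f (n + 1)` is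
constant with zero integral, hence zero because the interval has positive length. -/
lemma IsGeneralizedHaarSystem.exists_isSplittingSystem {f : ℕ → ℝ → ℝ}
    (hf : IsGeneralizedHaarSystem f) : ∃ A, IsSplittingSystem unitMeasure A f := by
  obtain ⟨𝒜, h𝒜, hmd, hnorm⟩ := hf
  choose a c b hac hcb hmem hsplit hkeep using h𝒜.split
  have hfil := h𝒜.isFiltration
  have hsub : ∀ n, Set.Ico (a n) (b n) ⊆ Set.Ico 0 1 := fun n =>
    (hfil.isPartition n).subset_Ico (hmem n)
  have hmemLp : ∀ n, MemLp (f n) 2 unitMeasure := fun n =>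
    ⟨(hmd.integrable n).aestronglyMeasurable, by rw [hnorm n]; exact ENNReal.one_lt_top⟩
  refine ⟨fun n => Set.Ico (a n) (b n), fun n => measurableSet_Ico, fun n => ?_,
    fun m n hmn => ?_, hmemLp, fun n => ?_, fun m n hmn => ?_, fun n => ?_, fun n => ?_⟩
  · rw [unitMeasure, measureReal_restrict_apply measurableSet_Ico,
      Set.inter_eq_left.2 (hsub n), Real.volume_real_Ico_of_le ((hac n).trans (hcb n)).le]
    linarith [hac n, hcb n]
  · obtain ⟨B, hB, hnB⟩ := hfil.exists_superset hmn.le (hmem n)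
    by_cases hBm : B = Set.Ico (a m) (b m)
    · exact Or.inl (hBm ▸ hnB)
    · exact Or.inr (((hfil.isPartition m).pairwiseDisjoint hB (hmem m) hBm).mono_left hnB)
  · refine (ae_restrict_iff' measurableSet_Ico).2 (ae_of_all _ fun x hx hxA => ?_)
    obtain ⟨B, hB, hxB⟩ := (hfil.isPartition n).exists_mem hx
    have hBne : B ≠ Set.Ico (a n) (b n) := fun he => hxA (he ▸ hxB)
    have hB' : B ∈ 𝒜 (n + 1) := by
      have : B ∈ children 𝒜 n B := by rw [hkeep n B hB hBne]; rfl
      exact this.1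
    have hint := hmd.integral_eq_zero n B hB
    rw [setIntegral_congr_fun ((hfil.isPartition n).measurableSet B hB) (g := fun _ => f (n + 1) x)
      (fun y hy => hmd.const_on (n + 1) B hB' y hy x hxB), setIntegral_const, smul_eq_mul] at hint
    have hvol : volume.real B ≠ 0 := by
      refine (ENNReal.toReal_pos (h𝒜.volume_pos hB).ne' ?_).ne'
      exact ((measure_mono ((hfil.isPartition n).subset_Ico hB)).trans_lt measure_Ico_lt_top).ne
    exact (mul_eq_zero.1 hint).resolve_left hvol
  · obtain ⟨B, hB, hnB⟩ := hfil.exists_superset hmn (hmem n)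
    have hab := (hac n).trans (hcb n)
    exact ⟨f m (a n), fun x hx =>
      hmd.const_on m B hB x (hnB hx) (a n) (hnB (Set.left_mem_Ico.2 hab))⟩
  · rw [unitMeasure, Measure.restrict_restrict_of_subset (hsub n)]
    exact hmd.integral_eq_zero n _ (hmem n)
  · have h1 := hnorm n
    rw [(hmemLp n).eLpNorm_eq_integral_rpow_norm two_ne_zero ENNReal.ofNat_ne_top,
      ENNReal.ofReal_eq_one] at h1
    simp only [ENNReal.toReal_ofNat, Real.rpow_two, Real.norm_eq_abs, sq_abs] at h1
    have h0 : 0 ≤ ∫ x, f n x ^ 2 ∂unitMeasure := integral_nonneg fun x => sq_nonneg _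
    rwa [Real.rpow_inv_eq h0 zero_le_one two_ne_zero, Real.one_rpow] at h1

end GenHaar

/-- The `n`-th term (`n = 0, 1, 2, …`) of the rearranged system is given the weight
`log₂ (n + 1)`. -/
theorem corollary2 (f : ℕ → ℝ → ℝ) (hf : GenHaar.IsGeneralizedHaarSystem f)
    (σ : Equiv.Perm ℕ) :
    GenHaar.IsCMultiplier (fun n : ℕ => Real.logb 2 ((n : ℝ) + 1)) (fun n => f (σ n)) := by
  obtain ⟨A, hA⟩ := hf.exists_isSplittingSystem
  refine ⟨⟨fun n => hA.memLp _, fun n => hA.integral_sq _, fun m n hmn =>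
    hA.orthogonal _ _ (σ.injective.ne hmn)⟩, fun n => ?_, fun m n hmn => ?_, ?_,
    fun a ha => hA.ae_exists_tendsto σ a ha⟩
  · exact Real.logb_nonneg one_lt_two (by linarith [(n.cast_nonneg : (0 : ℝ) ≤ n)])
  · have : (m : ℝ) ≤ n := Nat.cast_le.2 hmn
    exact Real.logb_le_logb_of_le one_lt_two (by positivity) (by linarith)
  · exact (Real.tendsto_logb_atTop one_lt_two).comp
      (tendsto_atTop_add_const_right _ _ tendsto_natCast_atTop_atTop)
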